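/- For an integer $m\ge 0$ let $[m] = \frac{q^{-m}-q^{m}}{q^{-1}-q} = q^{-m+1}+q^{-m+3}+\cdots+q^{m-1}\in\mathbb{Z}[q,q^{-1}]$ be the quantum integer (so $[0]=0$), and for $n\ge 0$ and $k\ge 0$ let $$\begin{bmatrix} n\\ k\end{bmatrix} = \frac{[n][n-1]\cdots[n-k+1]}{[k][k-1]\cdots[1]}\in\mathbb{Z}[q,q^{-1}]$$ be the quantum binomial, which is $0$ for $k>n$. A Laurent polynomial in $q$ is called centred if it is invariant under $q\mapsto q^{-1}$. It is called unimodal if its coefficients, read along the exponents of either parity, weakly increase up to some point and weakly decrease from there on. A sequence $a_0,a_1,a_2,\ldots$ of Laurent polynomials with non-negative integer coefficients (a finite sequence being extended by zeros) is called strongly Schur log-concave if for all $k\ge 1$ and $i\ge 0$ the difference $$a_{k+i}\,a_k - a_{k+i+1}\,a_{k-1}$$ is a unimodal centred Laurent polynomial with non-negative coefficients. **Corollary.** For every $n\ge 0$, the $n$th row $\begin{bmatrix} n\\ 0\end{bmatrix}, \begin{bmatrix} n\\ 1\end{bmatrix},\ldots,\begin{bmatrix} n\\ n\end{bmatrix}$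 of the quantum Pascal triangle is strongly Schur log-concave. Moreover, with $a_k=\begin{bmatrix} n\\ k\end{bmatrix}$, for all $k\ge1$ and $i\ge0$ the difference $a_{k+i}a_k-a_{k+i+1}a_{k-1}$ is a combination of the quantum integers $[1],[2],[3],\ldots$ with coefficients in $\mathbb{N}_0$, and it is the character of a finite-dimensional representation of $\mathrm{SL}_2(\mathbb{C})$, that is, there is such a representation on which $\mathrm{diag}(q,q^{-1})$ has trace $a_{k+i}a_k-a_{k+i+1}a_{k-1}$ evaluated at $q$, for every $q\in\mathbb{C}^\times$. -/

import Mathlib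

open scoped LaurentPolynomial MatrixGroups

noncomputable section

namespace QuantumPascal

/-- The quantum integer `[n] = q^(-n+1) + q^(-n+3) + ⋯ + q^(n-1)`, so that `[0] = 0`.
The variable `q` is `T 1`. -/
def quantumInt (n : ℕ) : ℤ[T;T⁻¹] :=
  ∑ j ∈ Finset.range n, LaurentPolynomial.T (2 * (j : ℤ) - (n : ℤ) + 1)

/-- `[n] = (q^(-n) - q^n) / (q^(-1) - q)`, written without denominators. -/
theorem quantumInt_mul (n : ℕ) :
    quantumInt n * (LaurentPolynomial.T (-1) - LaurentPolynomial.T 1) =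
      LaurentPolynomial.T (-(n : ℤ)) - LaurentPolynomial.T (n : ℤ) := by
  have h : ∀ m : ℕ, (∑ j ∈ Finset.range m,
      (LaurentPolynomial.T (2 * (j : ℤ) - (n : ℤ) + 1) : ℤ[T;T⁻¹])) *
        (LaurentPolynomial.T (-1) - LaurentPolynomial.T 1) =
      LaurentPolynomial.T (-(n : ℤ)) - LaurentPolynomial.T (2 * (m : ℤ) - n) := by
    intro m
    induction m with
    | zero => simp
    | succ m ih =>
      rw [Finset.sum_range_succ, add_mul, ih, mul_sub, ← LaurentPolynomial.T_add,
        ← LaurentPolynomial.T_add]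
      have h1 : 2 * (m : ℤ) - n + 1 + -1 = 2 * (m : ℤ) - n := by ring
      have h2 : 2 * (m : ℤ) - n + 1 + 1 = 2 * ((m + 1 : ℕ) : ℤ) - n := by push_cast; ring
      rw [h1, h2]
      ring
  have h3 := h n
  rw [show 2 * (n : ℤ) - n = n by ring] at h3
  exact h3

theorem quantumInt_one : quantumInt 1 = 1 := by
  simp [quantumInt]

theorem quantumInt_zero : quantumInt 0 = 0 := by
  simp [quantumInt]

theorem T_sub_T_ne_zero :
    (LaurentPolynomial.T (-1) - LaurentPolynomial.T 1 : ℤ[T;T⁻¹]) ≠ 0 := by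
  intro h
  have h2 := congrArg (LaurentPolynomial.eval₂ (Int.castRingHom ℚ) (Units.mk0 2 two_ne_zero)) h
  norm_num at h2

theorem quantumInt_ne_zero {n : ℕ} (hn : n ≠ 0) : quantumInt n ≠ 0 := by
  intro h
  have h1 := quantumInt_mul n
  rw [h, zero_mul] at h1
  have h2 := congrArg (LaurentPolynomial.eval₂ (Int.castRingHom ℚ) (Units.mk0 2 two_ne_zero)) h1
  simp only [map_zero, map_sub, LaurentPolynomial.eval₂_T] at h2
  have h3 : (1 : ℚ) < 2 ^ n := one_lt_pow₀ (by norm_num) hn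
  have h4 : ((2 : ℚ) ^ n)⁻¹ < 1 := inv_lt_one_of_one_lt₀ h3
  simp at h2
  linarith

/-- Addition rule `[a + b] = q^b [a] + q^(-a) [b]`. -/
theorem quantumInt_add (a b : ℕ) :
    quantumInt (a + b) =
      LaurentPolynomial.T (b : ℤ) * quantumInt a +
        LaurentPolynomial.T (-(a : ℤ)) * quantumInt b := by
  apply mul_right_cancel₀ T_sub_T_ne_zero
  rw [add_mul, mul_assoc, mul_assoc, quantumInt_mul, quantumInt_mul, quantumInt_mul, mul_sub,
    mul_sub, ← LaurentPolynomial.T_add, ← LaurentPolynomial.T_add, ← LaurentPolynomial.T_add,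
    ← LaurentPolynomial.T_add]
  have h1 : (b : ℤ) + -(a : ℤ) = -(a : ℤ) + b := by ring
  have h2 : -((a + b : ℕ) : ℤ) = -(a : ℤ) + -(b : ℤ) := by push_cast; ring
  have h3 : ((a + b : ℕ) : ℤ) = (b : ℤ) + a := by push_cast; ring
  rw [h1, h2, h3]
  ring

/-- The numerator `[n][n-1]⋯[n-k+1]`. For `k > n` a factor is `[0] = 0`, so the product is `0`
(the truncated subtraction only affects factors after that one). -/
def quantumDesc (n k : ℕ) : ℤ[T;T⁻¹] :=
  ∏ j ∈ Finset.range k, quantumInt (n - j)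

/-- The denominator `[k][k-1]⋯[1]`. -/
def quantumFactorial (k : ℕ) : ℤ[T;T⁻¹] :=
  ∏ j ∈ Finset.range k, quantumInt (j + 1)

theorem quantumFactorial_ne_zero (k : ℕ) : quantumFactorial k ≠ 0 :=
  Finset.prod_ne_zero_iff.mpr fun _ _ => quantumInt_ne_zero (Nat.succ_ne_zero _)

theorem quantumDesc_eq_zero {n k : ℕ} (h : n < k) : quantumDesc n k = 0 :=
  Finset.prod_eq_zero (Finset.mem_range.mpr h) (by simp [quantumInt_zero])

theorem quantumDesc_succ_succ (n k : ℕ) :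
    quantumDesc (n + 1) (k + 1) = quantumInt (n + 1) * quantumDesc n k := by
  unfold quantumDesc
  rw [Finset.prod_range_succ', mul_comm]
  simp

/-- The quotient `[n][n-1]⋯[n-k+1] / ([k][k-1]⋯[1])` is a Laurent polynomial. -/
theorem exists_quantumBinom (n k : ℕ) :
    ∃ a : ℤ[T;T⁻¹], a * quantumFactorial k = quantumDesc n k := by
  induction n generalizing k with
  | zero =>
    cases k with
    | zero => exact ⟨1, by simp [quantumFactorial, quantumDesc]⟩
    | succ k => exact ⟨0, by rw [quantumDesc_eq_zero (Nat.succ_pos k), zero_mul]⟩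
  | succ n ih =>
    cases k with
    | zero => exact ⟨1, by simp [quantumFactorial, quantumDesc]⟩
    | succ k =>
      rcases lt_or_ge n k with h | h
      · exact ⟨0, by rw [quantumDesc_eq_zero (Nat.succ_lt_succ h), zero_mul]⟩
      obtain ⟨a, ha⟩ := ih k
      obtain ⟨b, hb⟩ := ih (k + 1)
      refine ⟨LaurentPolynomial.T ((k + 1 : ℕ) : ℤ) * b +
        LaurentPolynomial.T (-((n - k : ℕ) : ℤ)) * a, ?_⟩
      have hf : quantumFactorial (k + 1) = quantumFactorial k * quantumInt (k + 1) :=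
        Finset.prod_range_succ _ _
      have hd : quantumDesc n (k + 1) = quantumDesc n k * quantumInt (n - k) :=
        Finset.prod_range_succ _ _
      have hn : n + 1 = (n - k) + (k + 1) := by omega
      rw [quantumDesc_succ_succ, hn, quantumInt_add, add_mul, mul_assoc, hb, hd, mul_assoc, hf,
        ← mul_assoc a, ha]
      ring

/-- The quantum binomial `[n choose k]`: the Laurent polynomial
`[n][n-1]⋯[n-k+1] / ([k][k-1]⋯[1])`, which is `0` for `k > n`. -/
def quantumBinom (n k : ℕ) : ℤ[T;T⁻¹] :=
  Classical.choose (exists_quantumBinom n k)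

theorem quantumBinom_mul (n k : ℕ) :
    quantumBinom n k * quantumFactorial k = quantumDesc n k :=
  Classical.choose_spec (exists_quantumBinom n k)

theorem eq_quantumBinom {n k : ℕ} {a : ℤ[T;T⁻¹]}
    (h : a * quantumFactorial k = quantumDesc n k) : a = quantumBinom n k :=
  mul_right_cancel₀ (quantumFactorial_ne_zero k) (h.trans (quantumBinom_mul n k).symm)

theorem quantumBinom_eq_zero {n k : ℕ} (h : n < k) : quantumBinom n k = 0 :=
  (eq_quantumBinom (by rw [zero_mul, quantumDesc_eq_zero h])).symm

/-- All coefficients are non-negative. -/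
def IsNonneg (a : ℤ[T;T⁻¹]) : Prop :=
  ∀ m : ℤ, 0 ≤ a.coeff m

/-- Invariance under `q ↦ q⁻¹`. -/
def IsCentred (a : ℤ[T;T⁻¹]) : Prop :=
  LaurentPolynomial.invert a = a

/-- Unimodality. Consecutive exponents in a quantum integer differ by `2`
(for instance `[2] = q⁻¹ + q`), so the coefficients are read along exponents of a fixed parity:
along each parity class they weakly increase up to some point and weakly decrease from there on. -/
def IsUnimodal (a : ℤ[T;T⁻¹]) : Prop :=
  ∀ r : ℤ, ∃ p : ℤ,
    MonotoneOn (fun m : ℤ => a.coeff (2 * m + r)) (Set.Iic p) ∧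
      AntitoneOn (fun m : ℤ => a.coeff (2 * m + r)) (Set.Ici p)

/-- A unimodal centred Laurent polynomial with non-negative coefficients. -/
structure IsSchurPositive (a : ℤ[T;T⁻¹]) : Prop where
  nonneg : IsNonneg a
  centred : IsCentred a
  unimodal : IsUnimodal a

/-- Strong Schur log-concavity of a sequence in `ℕ₀[q, q⁻¹]`. A finite sequence is extended
by `0`. -/
structure StronglySchurLogConcave (a : ℕ → ℤ[T;T⁻¹]) : Prop where
  nonneg : ∀ k, IsNonneg (a k)
  schurPositive : ∀ k i : ℕ, 1 ≤ k →
    IsSchurPositive (a (k + i) * a k - a (k + i + 1) * a (k - 1))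

/-- A finite combination of the quantum integers `[1], [2], [3], …` with coefficients in `ℕ`. -/
def IsQuantumIntPositive (a : ℤ[T;T⁻¹]) : Prop :=
  ∃ c : ℕ →₀ ℕ, a = c.sum fun m r => r • quantumInt (m + 1)

/-- The matrix `diag(q, q⁻¹)` in `SL₂(ℂ)`. -/
def torusElement (q : ℂˣ) : SL(2, ℂ) :=
  ⟨!![(q : ℂ), 0; 0, ((q⁻¹ : ℂˣ) : ℂ)], by simp [Matrix.det_fin_two_of]⟩

/-- `a` is the Weyl character of a finite dimensional representation `V` of `SL₂(ℂ)`: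
the trace of `diag(q, q⁻¹)` on `V` is `a(q)` for all `q`. -/
def IsSL2Character (a : ℤ[T;T⁻¹]) : Prop :=
  ∃ (V : Type) (_ : AddCommGroup V) (_ : Module ℂ V) (_ : FiniteDimensional ℂ V)
    (ρ : Representation ℂ SL(2, ℂ) V),
    ∀ q : ℂˣ, LinearMap.trace ℂ V (ρ (torusElement q)) =
      LaurentPolynomial.eval₂ (Int.castRingHom ℂ) q a

end QuantumPascal

end

/-! The argument is skew Howe duality. Let `V` be the irreducible `sl₂`-module of dimension `n`. The
exterior algebra of `V ⊕ V` has a basis indexed by subsets of `Fin n ⊕ Fin n`, and its part of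
bidegree `(a, b)` has character `quantumBinom n a * quantumBinom n b`. A second `sl₂` mixes the two
copies of `V`. Its raising operator `fockTransfer` maps bidegree `(k+i, k)` to `(k+i+1, k-1)` and
commutes with the first action. The target has dual weight `i + 2 > 0`, so this map is onto, and the
required difference is the character of its kernel (`coeff_pascalDiff`).

The kernel is stable under the lowering operator of the first `sl₂`, which is injective on positive
weights. Hence the coefficients at `m` and `m + 2` weakly decrease for `m ≥ -1`
(`coeff_pascalDiff_add_two_le`). With symmetry under `q ↦ q⁻¹` this gives unimodality and
non-negative multiplicities of quantum integers. Each quantum integer is then realised by binary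
forms.

No structure theory of `sl₂` is needed. In orthonormal bases the lowering operators are transposes
`Aᵀ`, and if `[A, Aᵀ]` is positive on the support of `v`, then `Aᵀ v = 0` forces `v = 0`
(`eq_zero_of_transpose_mulVec_eq_zero`). The commutators on the exterior algebra come from small
matrices through `secondQuant_commutator`. -/

noncomputable section

namespace QuantumPascal

/-! ### Fermionic Fock space and second quantization. -/

section Fock

open Matrix

variable {X : Type*} [Fintype X] [DecidableEq X]

/-- The Jordan–Wigner sign: `(-1)` to the number of elements of `S` preceding `x` in a fixed
enumeration of `X`. -/
def jwSign (x : X) (S : Finset X) : ℝ :=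
  ∏ y ∈ S, if Fintype.equivFin X y < Fintype.equivFin X x then -1 else 1

theorem jwSign_insert {x y : X} {S : Finset X} (h : y ∉ S) :
    jwSign x (insert y S) =
      (if Fintype.equivFin X y < Fintype.equivFin X x then -1 else 1) * jwSign x S :=
  Finset.prod_insert h

theorem jwSign_erase {x y : X} {S : Finset X} (h : y ∈ S) :
    jwSign x S =
      (if Fintype.equivFin X y < Fintype.equivFin X x then -1 else 1) * jwSign x (S.erase y) := by
  rw [← jwSign_insert (Finset.notMem_erase y S), Finset.insert_erase h]

theorem jwSign_erase_self (x : X) (S : Finset X) : jwSign x (S.erase x) = jwSign x S := by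
  by_cases h : x ∈ S
  · rw [jwSign_erase h]; simp
  · rw [Finset.erase_eq_of_notMem h]

omit [DecidableEq X] in
theorem jwSign_mul_self (x : X) (S : Finset X) : jwSign x S * jwSign x S = 1 := by
  unfold jwSign
  rw [← Finset.prod_mul_distrib]
  exact Finset.prod_eq_one fun y _ => by split_ifs <;> norm_num

omit [DecidableEq X] in
-- Exactly one of two distinct elements precedes the other; this is the source of all
-- anticommutation signs.
theorem jw_antisymm {x y : X} (h : x ≠ y) :
    (if Fintype.equivFin X y < Fintype.equivFin X x then (-1 : ℝ) else 1) =
      -(if Fintype.equivFin X x < Fintype.equivFin X y then -1 else 1) := by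
  rcases lt_or_gt_of_ne ((Fintype.equivFin X).injective.ne h) with h | h
  · simp [h, h.not_gt]
  · simp [h, h.not_gt]

/-- The fermionic annihilation operator at `x` on the space with basis the subsets of `X`. -/
def annih (x : X) : Matrix (Finset X) (Finset X) ℝ :=
  Matrix.of fun S T => if x ∉ S ∧ T = insert x S then jwSign x S else 0

theorem annih_mulVec (x : X) (v : Finset X → ℝ) (S : Finset X) :
    (annih x *ᵥ v) S = if x ∈ S then 0 else jwSign x S * v (insert x S) := by
  by_cases h : x ∈ S <;> simp [annih, mulVec, dotProduct, h]

theorem annih_transpose_mulVec (x : X) (v : Finset X → ℝ) (S : Finset X) :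
    ((annih x)ᵀ *ᵥ v) S = if x ∈ S then jwSign x S * v (S.erase x) else 0 := by
  have h1 : ∀ U : Finset X, (x ∉ U ∧ S = insert x U) ↔ (x ∈ S ∧ U = S.erase x) := by
    intro U
    constructor
    · rintro ⟨h, rfl⟩
      exact ⟨Finset.mem_insert_self _ _, (Finset.erase_insert h).symm⟩
    · rintro ⟨h, rfl⟩
      exact ⟨Finset.notMem_erase _ _, (Finset.insert_erase h).symm⟩
  by_cases h : x ∈ S <;> simp [annih, mulVec, dotProduct, h1, h, jwSign_erase_self]

theorem matrix_ext_mulVec {m : Type*} [Fintype m] {A B : Matrix m m ℝ}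
    (h : ∀ v i, (A *ᵥ v) i = (B *ᵥ v) i) : A = B := by
  classical
  exact Matrix.toLin'.injective (LinearMap.ext fun v => funext fun i => by simpa using h v i)

theorem annih_mul_annih (x y : X) : annih x * annih y = -(annih y * annih x) := by
  refine matrix_ext_mulVec fun v S => ?_
  rw [neg_mulVec, Pi.neg_apply, ← mulVec_mulVec, ← mulVec_mulVec]
  simp only [annih_mulVec, Finset.mem_insert]
  by_cases hxy : x = y
  · subst hxy; simp
  by_cases hx : x ∈ S
  · simp [hx]
  by_cases hy : y ∈ S
  · simp [hy]
  simp only [hx, hy, hxy, Ne.symm hxy, or_self, if_false]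
  rw [jwSign_insert hx, jwSign_insert hy, jw_antisymm hxy, Finset.insert_comm]
  ring

theorem annih_transpose_mul_annih_transpose (x y : X) :
    (annih x)ᵀ * (annih y)ᵀ = -((annih y)ᵀ * (annih x)ᵀ) := by
  rw [← transpose_mul, ← transpose_mul, annih_mul_annih, transpose_neg]

/-- The mixed canonical anticommutation relation. For `x = y` exactly one of the two products
survives on each basis vector; for `x ≠ y` the two orders differ by one sign. -/
theorem annih_mul_annih_transpose (x y : X) :
    annih x * (annih y)ᵀ =
      (if x = y then 1 else 0 : Matrix (Finset X) (Finset X) ℝ) - (annih y)ᵀ * annih x := by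
  refine matrix_ext_mulVec fun v S => ?_
  rw [sub_mulVec, Pi.sub_apply, ← mulVec_mulVec, ← mulVec_mulVec]
  simp only [annih_mulVec, annih_transpose_mulVec, Finset.mem_insert, Finset.mem_erase]
  by_cases hxy : x = y
  · subst hxy
    by_cases hx : x ∈ S
    · simp [hx, jwSign_erase_self, ← mul_assoc, jwSign_mul_self]
    · simp [hx, jwSign_insert hx, ← mul_assoc, jwSign_mul_self]
  by_cases hx : x ∈ S
  · simp [hx, hxy]
  by_cases hy : y ∈ S
  · simp only [hx, hy, hxy, or_true, if_true, if_false, and_false, zero_mulVec, Pi.zero_apply]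
    rw [jwSign_insert hx, jwSign_erase (x := x) hy, jw_antisymm hxy,
      Finset.erase_insert_of_ne hxy]
    have h2 : (if Fintype.equivFin X x < Fintype.equivFin X y then (-1 : ℝ) else 1) *
      (if Fintype.equivFin X x < Fintype.equivFin X y then (-1 : ℝ) else 1) = 1 := by
      split_ifs <;> norm_num
    linear_combination (-jwSign x (S.erase y) * jwSign y S * v (insert x (S.erase y))) * h2
  · simp [hx, hy, hxy, Ne.symm hxy]

/-- Second quantization: the action of `gl(X)` on the exterior algebra of `ℝ^X`. -/
def secondQuant (A : Matrix X X ℝ) : Matrix (Finset X) (Finset X) ℝ :=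
  ∑ x, ∑ y, A x y • ((annih x)ᵀ * annih y)

theorem secondQuant_transpose (A : Matrix X X ℝ) : secondQuant Aᵀ = (secondQuant A)ᵀ := by
  unfold secondQuant
  rw [Finset.sum_comm]
  simp [transpose_sum]

theorem secondQuant_sub (A B : Matrix X X ℝ) :
    secondQuant (A - B) = secondQuant A - secondQuant B := by
  simp [secondQuant, sub_smul]

theorem secondQuant_smul (c : ℝ) (A : Matrix X X ℝ) :
    secondQuant (c • A) = c • secondQuant A := by
  simp [secondQuant, Finset.smul_sum, mul_smul]

theorem secondQuant_zero : secondQuant (0 : Matrix X X ℝ) = 0 := by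
  simp [secondQuant]

/-- `(annih x)ᵀ * annih x` is the number operator, the projection onto the subsets containing `x`.
-/
theorem secondQuant_diagonal (h : X → ℝ) :
    secondQuant (diagonal h) = diagonal fun S => ∑ x ∈ S, h x := by
  refine matrix_ext_mulVec fun v S => ?_
  have h1 : secondQuant (diagonal h) = ∑ x, h x • ((annih x)ᵀ * annih x) := by
    refine Finset.sum_congr rfl fun x _ => ?_
    rw [Finset.sum_eq_single x]
    · simp
    · intro y _ hy; simp [diagonal_apply_ne' _ hy]
    · simp
  have h2 : ∀ x, ((h x • ((annih x)ᵀ * annih x)) *ᵥ v) S = if x ∈ S then h x * v S else 0 := by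
    intro x
    rw [smul_mulVec, Pi.smul_apply, ← mulVec_mulVec, annih_transpose_mulVec, annih_mulVec]
    by_cases hx : x ∈ S
    · simp [hx, jwSign_erase_self, ← mul_assoc, jwSign_mul_self]
    · simp [hx]
  rw [h1, mulVec_diagonal, sum_mulVec, Finset.sum_apply, Finset.sum_congr rfl fun x _ => h2 x,
    Finset.sum_mul]
  simp

/-- The quadratic operators obey the commutation relations of matrix units. -/
theorem hop_mul_hop (x y z w : X) :
    ((annih x)ᵀ * annih y) * ((annih z)ᵀ * annih w) -
      ((annih z)ᵀ * annih w) * ((annih x)ᵀ * annih y) =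
    (if y = z then (annih x)ᵀ * annih w else 0) - if w = x then (annih z)ᵀ * annih y else 0 := by
  have h1 : ((annih x)ᵀ * annih y) * ((annih z)ᵀ * annih w) =
      (annih x)ᵀ * (annih y * (annih z)ᵀ) * annih w := by noncomm_ring
  have h2 : ((annih z)ᵀ * annih w) * ((annih x)ᵀ * annih y) =
      (annih z)ᵀ * (annih w * (annih x)ᵀ) * annih y := by noncomm_ring
  -- The quartic terms left after normal ordering agree: swapping the two creators and the two
  -- annihilators costs two signs.
  have h3 : (annih z)ᵀ * ((annih x)ᵀ * annih w) * annih y =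
      (annih x)ᵀ * ((annih z)ᵀ * annih y) * annih w := by
    calc _ = ((annih z)ᵀ * (annih x)ᵀ) * (annih w * annih y) := by noncomm_ring
      _ = _ := by
        rw [annih_transpose_mul_annih_transpose z x, annih_mul_annih w y]; noncomm_ring
  rw [h1, h2, annih_mul_annih_transpose, annih_mul_annih_transpose, mul_sub, mul_sub, sub_mul,
    sub_mul, h3]
  by_cases hy : y = z <;> by_cases hw : w = x <;> (simp [hy, hw]; try abel)

omit [DecidableEq X] in
theorem sum_comm_four {M : Type*} [AddCommMonoid M] (f : X → X → X → X → M) :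
    ∑ z, ∑ w, ∑ x, ∑ y, f z w x y = ∑ x, ∑ y, ∑ z, ∑ w, f z w x y := by
  have h := Finset.sum_comm (s := (Finset.univ : Finset (X × X)))
    (t := (Finset.univ : Finset (X × X))) (f := fun p r => f p.1 p.2 r.1 r.2)
  simpa only [Fintype.sum_prod_type] using h

/-- By bilinearity this follows from the case of matrix units. It reduces commutators on the
exterior algebra to commutators of matrices indexed by `X`. -/
theorem secondQuant_commutator (A B : Matrix X X ℝ) :
    secondQuant A * secondQuant B - secondQuant B * secondQuant A =
      secondQuant (A * B - B * A) := by
  have h1 : secondQuant A * secondQuant B = ∑ x, ∑ y, ∑ z, ∑ w, (A x y * B z w) •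
      (((annih x)ᵀ * annih y) * ((annih z)ᵀ * annih w)) := by
    unfold secondQuant
    simp_rw [Finset.sum_mul, Finset.mul_sum, smul_mul_smul_comm]
  have h2 : secondQuant B * secondQuant A = ∑ x, ∑ y, ∑ z, ∑ w, (A x y * B z w) •
      (((annih z)ᵀ * annih w) * ((annih x)ᵀ * annih y)) := by
    unfold secondQuant
    simp_rw [Finset.sum_mul, Finset.mul_sum, smul_mul_smul_comm]
    rw [sum_comm_four]
    simp_rw [mul_comm (B _ _)]
  rw [h1, h2, secondQuant_sub]
  simp only [← Finset.sum_sub_distrib, ← smul_sub, hop_mul_hop]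
  simp only [smul_sub, Finset.sum_sub_distrib]
  congr 1
  · simp only [secondQuant, mul_apply, Finset.sum_smul]
    refine Finset.sum_congr rfl fun x _ => ?_
    rw [Finset.sum_comm (s := Finset.univ) (t := Finset.univ)
      (f := fun w y => (A x y * B y w) • ((annih x)ᵀ * annih w))]
    refine Finset.sum_congr rfl fun y _ => ?_
    rw [Finset.sum_comm]
    simp
  · simp only [secondQuant, mul_apply, Finset.sum_smul]
    rw [sum_comm_four]
    refine Finset.sum_congr rfl fun z _ => ?_
    have h3 : ∀ w x y, (A x y * B z w) •
        (if w = x then (annih z)ᵀ * annih y else 0 : Matrix (Finset X) (Finset X) ℝ) =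
        if w = x then (B z w * A w y) • ((annih z)ᵀ * annih y) else 0 := by
      intro w x y
      split_ifs with h
      · rw [h, mul_comm]
      · rw [smul_zero]
    simp only [h3]
    rw [Finset.sum_comm (s := Finset.univ) (t := Finset.univ)
      (f := fun y x => (B z x * A x y) • ((annih z)ᵀ * annih y))]
    refine Finset.sum_congr rfl fun w _ => ?_
    rw [Finset.sum_comm]
    simp

end Fock

/-! ### Quantum binomials as generating functions of subsets. -/

section Subsets

open LaurentPolynomial

/-- The generating function of the `k`-element subsets of `{0, …, n-1}`, where `j` has
weight `2j - n + 1`. -/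
def subsetGen (n k : ℕ) : ℤ[T;T⁻¹] :=
  ∑ S ∈ (Finset.range n).powersetCard k, T (∑ j ∈ S, (2 * (j : ℤ) - n + 1))

theorem subsetGen_zero_right (n : ℕ) : subsetGen n 0 = 1 := by
  simp [subsetGen]

theorem subsetGen_zero_succ (k : ℕ) : subsetGen 0 (k + 1) = 0 := by
  rw [subsetGen, Finset.powersetCard_eq_empty.mpr (by simp), Finset.sum_empty]

theorem subset_weight_succ (n k : ℕ) (S : Finset ℕ) (hS : S.card = k) :
    ∑ j ∈ S, (2 * (j : ℤ) - (n + 1 : ℕ) + 1) = -(k : ℤ) + ∑ j ∈ S, (2 * (j : ℤ) - n + 1) := by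
  rw [← hS]
  simp only [Finset.sum_add_distrib, Finset.sum_sub_distrib, Finset.sum_const, nsmul_eq_mul]
  push_cast
  ring

/-- Subsets are split by whether they contain `n`, which has weight `n` in the new row; every old
element drops in weight by one. -/
theorem subsetGen_succ_succ (n k : ℕ) :
    subsetGen (n + 1) (k + 1) =
      T (-((k + 1 : ℕ) : ℤ)) * subsetGen n (k + 1) + T ((n : ℤ) - k) * subsetGen n k := by
  unfold subsetGen
  rw [Finset.range_add_one, Finset.powersetCard_succ_insert Finset.notMem_range_self,
    Finset.sum_union, Finset.sum_image, Finset.mul_sum, Finset.mul_sum]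
  · congr 1
    · refine Finset.sum_congr rfl fun S hS => ?_
      rw [subset_weight_succ n _ S (Finset.mem_powersetCard.mp hS).2, T_add]
    · refine Finset.sum_congr rfl fun S hS => ?_
      obtain ⟨h1, h2⟩ := Finset.mem_powersetCard.mp hS
      have hn : n ∉ S := fun h => Finset.notMem_range_self (h1 h)
      rw [Finset.sum_insert hn, subset_weight_succ n _ S h2, ← T_add]
      congr 1
      push_cast
      ring
  · intro S hS S' hS' h
    have hn : n ∉ S := fun h =>
      Finset.notMem_range_self ((Finset.mem_powersetCard.mp hS).1 h)
    have hn' : n ∉ S' := fun h =>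
      Finset.notMem_range_self ((Finset.mem_powersetCard.mp hS').1 h)
    rw [← Finset.erase_insert hn, ← Finset.erase_insert hn', h]
  · rw [Finset.disjoint_left]
    intro S hS hS'
    obtain ⟨S', -, rfl⟩ := Finset.mem_image.mp hS'
    exact Finset.notMem_range_self
      ((Finset.mem_powersetCard.mp hS).1 (Finset.mem_insert_self _ _))

/-- The mirror image of `quantumInt_add`, with the powers of `q` that occur in
`subsetGen_succ_succ`. -/
theorem quantumInt_add' (a b : ℕ) :
    quantumInt (a + b) = T (-(b : ℤ)) * quantumInt a + T (a : ℤ) * quantumInt b := by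
  rw [add_comm a b, quantumInt_add, add_comm]

theorem subsetGen_mul (n k : ℕ) : subsetGen n k * quantumFactorial k = quantumDesc n k := by
  induction n generalizing k with
  | zero =>
    cases k with
    | zero => simp [subsetGen_zero_right, quantumFactorial, quantumDesc]
    | succ k => rw [subsetGen_zero_succ, quantumDesc_eq_zero (Nat.succ_pos k), zero_mul]
  | succ n ih =>
    cases k with
    | zero => simp [subsetGen_zero_right, quantumFactorial, quantumDesc]
    | succ k =>
      have hf : quantumFactorial (k + 1) = quantumFactorial k * quantumInt (k + 1) :=
        Finset.prod_range_succ _ _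
      have hd : quantumDesc n (k + 1) = quantumDesc n k * quantumInt (n - k) :=
        Finset.prod_range_succ _ _
      rw [subsetGen_succ_succ, add_mul, mul_assoc, ih, mul_assoc, hf, ← mul_assoc (subsetGen n k),
        ih, hd, quantumDesc_succ_succ]
      rcases lt_or_ge n k with h | h
      -- For `k > n` the subtraction `n - k` truncates, but both sides carry the vanishing factor
      -- `quantumDesc n k`.
      · rw [quantumDesc_eq_zero h]; ring
      have h1 : quantumInt (n + 1) = quantumInt ((n - k) + (k + 1)) := by congr 1; omega
      rw [h1, quantumInt_add' (n - k) (k + 1), Nat.cast_sub h]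
      ring

theorem quantumBinom_eq_subsetGen (n k : ℕ) : quantumBinom n k = subsetGen n k :=
  (eq_quantumBinom (subsetGen_mul n k)).symm

/-- The weight of a subset of `Fin n`, where `j` has weight `2j - n + 1`. -/
def subsetWeight {n : ℕ} (S : Finset (Fin n)) : ℤ := ∑ j ∈ S, (2 * ((j : ℕ) : ℤ) - n + 1)

theorem quantumBinom_eq_sum (n k : ℕ) :
    quantumBinom n k = ∑ S : Finset (Fin n) with S.card = k, T (subsetWeight S) := by
  have h : Finset.range n = (Finset.univ : Finset (Fin n)).map Fin.valEmbedding := by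
    rw [Fin.map_valEmbedding_univ, Nat.Iio_eq_range]
  rw [quantumBinom_eq_subsetGen, subsetGen, h, Finset.powersetCard_map, Finset.sum_map,
    Finset.powersetCard_eq_filter, Finset.powerset_univ]
  refine Finset.sum_congr rfl fun S _ => ?_
  simp [subsetWeight]

theorem coeff_finset_sum {ι : Type*} (s : Finset ι) (f : ι → ℤ[T;T⁻¹]) (m : ℤ) :
    (∑ i ∈ s, f i).coeff m = ∑ i ∈ s, (f i).coeff m := by
  simp

/-- Coefficients of a product of two quantum binomials count pairs of subsets, encoded as subsets
of `Fin n ⊕ Fin n`. -/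
theorem coeff_quantumBinom_mul (n a b : ℕ) (m : ℤ) :
    (quantumBinom n a * quantumBinom n b).coeff m =
      Fintype.card {S : Finset (Fin n ⊕ Fin n) // S.toLeft.card = a ∧ S.toRight.card = b ∧
        subsetWeight S.toLeft + subsetWeight S.toRight = m} := by
  rw [quantumBinom_eq_sum, quantumBinom_eq_sum, Finset.sum_mul_sum, ← Finset.sum_product',
    coeff_finset_sum]
  simp only [← T_add, T_apply]
  rw [Finset.sum_boole, Fintype.card_subtype, ← Finset.card_map Finset.sumEquiv.toEmbedding,
    Nat.cast_inj]
  congr 1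
  ext p
  simp [Finset.mem_map_equiv, and_assoc]

theorem isNonneg_quantumBinom (n k : ℕ) : IsNonneg (quantumBinom n k) := by
  intro m
  rw [quantumBinom_eq_sum, coeff_finset_sum]
  exact Finset.sum_nonneg fun S _ => by rw [T_apply]; split_ifs <;> norm_num

theorem invert_quantumInt (n : ℕ) : invert (quantumInt n) = quantumInt n := by
  unfold quantumInt
  rw [map_sum, ← Finset.sum_range_reflect]
  refine Finset.sum_congr rfl fun j hj => ?_
  rw [invert_T]
  have := Finset.mem_range.mp hj
  congr 1
  omega

theorem invert_quantumBinom (n k : ℕ) : invert (quantumBinom n k) = quantumBinom n k := by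
  refine eq_quantumBinom ?_
  have h1 : invert (quantumFactorial k) = quantumFactorial k := by
    simp [quantumFactorial, invert_quantumInt]
  have h2 : invert (quantumDesc n k) = quantumDesc n k := by
    simp [quantumDesc, invert_quantumInt]
  rw [← h2, ← quantumBinom_mul, map_mul, h1]

end Subsets

/-! ### Linear algebra of graded real spaces with a raising operator. -/

section WeightSpaces

open Matrix

variable {ι : Type*} [Fintype ι] [DecidableEq ι]

/-- Vectors supported on the indices satisfying `P`. -/
def supportedOn (P : ι → Prop) : Submodule ℝ (ι → ℝ) where
  carrier := {v | ∀ i, ¬ P i → v i = 0}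
  add_mem' hv hw i hi := by simp [hv i hi, hw i hi]
  zero_mem' _ _ := rfl
  smul_mem' c v hv i hi := by simp [hv i hi]

omit [DecidableEq ι] in
theorem finrank_supportedOn (P : ι → Prop) [DecidablePred P] :
    Module.finrank ℝ (supportedOn P) = Fintype.card {i // P i} := by
  have e : supportedOn P ≃ₗ[ℝ] ({i // P i} → ℝ) :=
    { toFun := fun v i => v.1 i
      map_add' := fun _ _ => rfl
      map_smul' := fun _ _ => rfl
      invFun := fun f => ⟨fun i => if h : P i then f ⟨i, h⟩ else 0, fun i hi => by simp [hi]⟩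
      left_inv := fun v => by
        ext i
        by_cases h : P i
        · simp [h]
        · simp [h, v.2 i h]
      right_inv := fun f => by
        ext i
        simp [i.2] }
  rw [e.finrank_eq, Module.finrank_fintype_fun_eq_card]

omit [DecidableEq ι] in
theorem mulVec_mem_supportedOn {A : Matrix ι ι ℝ} {P Q : ι → Prop}
    (h : ∀ i j, A i j ≠ 0 → P j → Q i) {v : ι → ℝ} (hv : v ∈ supportedOn P) :
    A *ᵥ v ∈ supportedOn Q := by
  intro i hi
  refine Finset.sum_eq_zero fun j _ => ?_
  by_cases hA : A i j = 0
  · simp [hA]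
  · simp [hv j fun hj => hi (h i j hA hj)]

/-- If `A Aᵀ - Aᵀ A` is positive on the support of `v`, then `Aᵀ` does not kill `v`. -/
theorem eq_zero_of_transpose_mulVec_eq_zero {A : Matrix ι ι ℝ} {d : ι → ℝ}
    (hA : A * Aᵀ - Aᵀ * A = diagonal d) {P : ι → Prop} (hd : ∀ i, P i → 0 < d i)
    {v : ι → ℝ} (hv : v ∈ supportedOn P) (h0 : Aᵀ *ᵥ v = 0) : v = 0 := by
  have h1 : v ⬝ᵥ ((A * Aᵀ - Aᵀ * A) *ᵥ v) = -((A *ᵥ v) ⬝ᵥ (A *ᵥ v)) := by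
    rw [sub_mulVec, ← mulVec_mulVec, h0, mulVec_zero, zero_sub, dotProduct_neg, ← mulVec_mulVec,
      dotProduct_mulVec, vecMul_transpose]
  have h2 : 0 ≤ (A *ᵥ v) ⬝ᵥ (A *ᵥ v) := Finset.sum_nonneg fun i _ => mul_self_nonneg _
  have h3 : ∀ i ∈ Finset.univ, 0 ≤ v i * (d i * v i) := by
    intro i _
    by_cases hi : P i
    · have := mul_nonneg (hd i hi).le (mul_self_nonneg (v i))
      linarith
    · simp [hv i hi]
  have h4 : ∑ i, v i * (d i * v i) = 0 := by
    refine le_antisymm ?_ (Finset.sum_nonneg h3)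
    rw [hA] at h1
    simp only [dotProduct, mulVec_diagonal] at h1 h2
    linarith
  ext i
  by_cases hi : P i
  · have h5 := (Finset.sum_eq_zero_iff_of_nonneg h3).mp h4 i (Finset.mem_univ i)
    rcases mul_eq_zero.mp h5 with h | h
    · exact h
    · exact (mul_eq_zero.mp h).resolve_left (hd i hi).ne'
  · exact hv i hi

omit [DecidableEq ι] in
-- If `A Aᵀ v = 0` then `Aᵀ v` has norm zero, so `A Aᵀ` is injective on `V₂`, hence bijective there.
-- Thus `A` maps `V₁` onto `V₂`, and rank-nullity applies.
theorem finrank_inf_ker_add {A : Matrix ι ι ℝ} {V₁ V₂ : Submodule ℝ (ι → ℝ)}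
    (h₁ : ∀ v ∈ V₁, A *ᵥ v ∈ V₂) (h₂ : ∀ v ∈ V₂, Aᵀ *ᵥ v ∈ V₁)
    (h₀ : ∀ v ∈ V₂, Aᵀ *ᵥ v = 0 → v = 0) :
    Module.finrank ℝ ↥(V₁ ⊓ LinearMap.ker A.mulVecLin) + Module.finrank ℝ V₂ =
      Module.finrank ℝ V₁ := by
  let φ : V₁ →ₗ[ℝ] V₂ := A.mulVecLin.restrict h₁
  let ψ : V₂ →ₗ[ℝ] V₁ := Aᵀ.mulVecLin.restrict h₂
  have hinj : Function.Injective (φ ∘ₗ ψ) := by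
    rw [← LinearMap.ker_eq_bot, LinearMap.ker_eq_bot']
    intro v hv
    have h3 : A *ᵥ (Aᵀ *ᵥ v.1) = 0 := congrArg Subtype.val hv
    have h4 : (Aᵀ *ᵥ v.1) ⬝ᵥ (Aᵀ *ᵥ v.1) = 0 := by
      rw [dotProduct_mulVec, vecMul_transpose, h3, zero_dotProduct]
    exact Subtype.ext (h₀ v.1 v.2 (dotProduct_self_eq_zero.mp h4))
  have hsurj : Function.Surjective φ :=
    Function.Surjective.of_comp (LinearMap.injective_iff_surjective.mp hinj)
  have h5 := LinearMap.finrank_range_add_finrank_ker φ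
  rw [LinearMap.range_eq_top.mpr hsurj, finrank_top] at h5
  have h6 : LinearMap.ker φ = (LinearMap.ker A.mulVecLin).comap V₁.subtype := by
    ext v
    exact Subtype.ext_iff
  have h7 : V₁ ⊓ LinearMap.ker A.mulVecLin = (LinearMap.ker φ).map V₁.subtype := by
    rw [h6, Submodule.map_comap_subtype]
  rw [h7, Submodule.finrank_map_subtype_eq, add_comm, h5]

omit [DecidableEq ι] in
theorem finrank_le_of_mulVec {A : Matrix ι ι ℝ} {V₁ V₂ : Submodule ℝ (ι → ℝ)}
    (h₁ : ∀ v ∈ V₁, A *ᵥ v ∈ V₂) (h₀ : ∀ v ∈ V₁, A *ᵥ v = 0 → v = 0) :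
    Module.finrank ℝ V₁ ≤ Module.finrank ℝ V₂ := by
  refine LinearMap.finrank_le_finrank_of_injective (f := A.mulVecLin.restrict h₁) ?_
  rw [← LinearMap.ker_eq_bot, LinearMap.ker_eq_bot']
  exact fun v hv => Subtype.ext (h₀ v.1 v.2 (congrArg Subtype.val hv))

/-- Second quantization is compatible with gradings. -/
theorem secondQuant_apply_ne_zero {A : Matrix ι ι ℝ} {h : ι → ℝ} {c : ℝ}
    (hA : ∀ x y, A x y ≠ 0 → h x = h y + c) {S T : Finset ι} (hST : secondQuant A S T ≠ 0) :
    ∑ x ∈ S, h x = ∑ x ∈ T, h x + c := by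
  -- Homogeneity of degree `c` is the eigenvalue equation `[diagonal h, A] = c A`, which second
  -- quantization preserves.
  have h1 : diagonal h * A - A * diagonal h = c • A := by
    ext x y
    rw [Matrix.sub_apply, diagonal_mul, mul_diagonal, Matrix.smul_apply, smul_eq_mul]
    by_cases h0 : A x y = 0
    · simp [h0]
    · rw [hA x y h0]; ring
  have h2 := congrFun (congrFun (secondQuant_commutator (diagonal h) A) S) T
  rw [h1, secondQuant_smul, secondQuant_diagonal, Matrix.sub_apply, diagonal_mul, mul_diagonal,
    Matrix.smul_apply, smul_eq_mul] at h2
  exact mul_right_cancel₀ hST (by linear_combination h2)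

end WeightSpaces

/-! ### The two commuting `sl₂` actions on the exterior algebra. -/

section Howe

open Matrix

variable (n : ℕ)

theorem fromBlocks_sub_fromBlocks {l : Type*} (A B C D A' B' C' D' : Matrix l l ℝ) :
    fromBlocks A B C D - fromBlocks A' B' C' D' =
      fromBlocks (A - A') (B - B') (C - C') (D - D') := by
  simp only [sub_eq_add_neg, fromBlocks_neg, fromBlocks_add]

/-- The raising operator of `sl₂` on its irreducible representation of dimension `n`, in an
orthonormal basis of weight vectors. -/
def raising : Matrix (Fin n) (Fin n) ℝ :=
  Matrix.of fun i j =>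
    if (i : ℕ) = j + 1 then Real.sqrt (((j : ℕ) + 1) * ((n : ℝ) - 1 - (j : ℕ))) else 0

/-- The weights of the irreducible representation of dimension `n`. -/
def irrWeight (j : Fin n) : ℝ := 2 * ((j : ℕ) : ℝ) - n + 1

theorem raising_ne_zero {i j : Fin n} (h : raising n i j ≠ 0) :
    irrWeight n i = irrWeight n j + 2 := by
  have h1 : (i : ℕ) = j + 1 := by
    by_contra h2
    exact h (by simp [raising, h2])
  simp only [irrWeight, h1]
  push_cast
  ring

/-- Only diagonal entries survive, and `i(n - i) - (i + 1)(n - 1 - i) = 2i - n + 1`. -/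
theorem raising_commutator :
    raising n * (raising n)ᵀ - (raising n)ᵀ * raising n = diagonal (irrWeight n) := by
  have hs : ∀ j : Fin n, 0 ≤ (((j : ℕ) : ℝ) + 1) * ((n : ℝ) - 1 - (j : ℕ)) := by
    intro j
    have : ((j : ℕ) : ℝ) + 1 ≤ n := by exact_mod_cast j.2
    exact mul_nonneg (by positivity) (by linarith)
  ext i k
  rw [Matrix.sub_apply, mul_apply, mul_apply]
  simp only [transpose_apply, raising, of_apply]
  by_cases hik : i = k
  · subst hik
    rw [diagonal_apply_eq, irrWeight]
    have h1 : ∑ l : Fin n, ((if (i : ℕ) = l + 1 then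
        Real.sqrt (((l : ℕ) + 1) * ((n : ℝ) - 1 - (l : ℕ))) else 0) *
        (if (i : ℕ) = l + 1 then Real.sqrt (((l : ℕ) + 1) * ((n : ℝ) - 1 - (l : ℕ))) else 0)) =
        (i : ℕ) * ((n : ℝ) - (i : ℕ)) := by
      obtain ⟨i, hi⟩ := i
      cases i with
      | zero => simp
      | succ i =>
        rw [Finset.sum_eq_single ⟨i, by omega⟩]
        · have h2 := hs ⟨i, by omega⟩
          simp only at h2
          simp only [if_true, Real.mul_self_sqrt h2]
          push_cast
          ring
        · intro l _ hl
          have : i ≠ (l : ℕ) := fun h => hl (Fin.ext h.symm)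
          simp [this]
        · simp
    have h2 : ∑ l : Fin n, ((if (l : ℕ) = i + 1 then
        Real.sqrt (((i : ℕ) + 1) * ((n : ℝ) - 1 - (i : ℕ))) else 0) *
        (if (l : ℕ) = i + 1 then Real.sqrt (((i : ℕ) + 1) * ((n : ℝ) - 1 - (i : ℕ))) else 0)) =
        ((i : ℕ) + 1) * ((n : ℝ) - 1 - (i : ℕ)) := by
      by_cases hi : (i : ℕ) + 1 < n
      · rw [Finset.sum_eq_single ⟨i + 1, hi⟩]
        · simp only [if_true, Real.mul_self_sqrt (hs i)]
        · intro l _ hl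
          have : (l : ℕ) ≠ i + 1 := fun h => hl (Fin.ext h)
          simp [this]
        · simp
      -- At the top weight the sum is empty, and the claimed value vanishes too since `n - 1 - i =
      -- 0`.
      · have h3 : (i : ℕ) + 1 = n := by omega
        have h4 : ((i : ℕ) : ℝ) + 1 = n := by exact_mod_cast h3
        rw [Finset.sum_eq_zero fun l _ => by
          rw [if_neg (by omega), zero_mul]]
        rw [show (n : ℝ) - 1 - (i : ℕ) = 0 by linarith, mul_zero]
    rw [h1, h2]
    ring
  · rw [diagonal_apply_ne _ hik]
    have hik' : (i : ℕ) ≠ k := fun h => hik (Fin.ext h)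
    rw [Finset.sum_eq_zero fun l _ => ?_, Finset.sum_eq_zero fun l _ => ?_, sub_zero]
    · by_cases h : (l : ℕ) = i + 1
      · rw [if_neg (c := (l : ℕ) = k + 1) (by omega), mul_zero]
      · rw [if_neg h, zero_mul]
    · by_cases h : (i : ℕ) = l + 1
      · rw [if_neg (c := (k : ℕ) = l + 1) (by omega), mul_zero]
      · rw [if_neg h, zero_mul]

/-- The raising operator of `sl₂` on the exterior algebra of two copies of the irreducible
representation of dimension `n`. -/
def fockRaising : Matrix (Finset (Fin n ⊕ Fin n)) (Finset (Fin n ⊕ Fin n)) ℝ :=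
  secondQuant (fromBlocks (raising n) 0 0 (raising n))

/-- The raising operator of the dual `sl₂`, exchanging the two copies. -/
def fockTransfer : Matrix (Finset (Fin n ⊕ Fin n)) (Finset (Fin n ⊕ Fin n)) ℝ :=
  secondQuant (fromBlocks 0 1 0 0)

theorem sum_sumElim (f g : Fin n → ℝ) (S : Finset (Fin n ⊕ Fin n)) :
    ∑ x ∈ S, Sum.elim f g x = ∑ j ∈ S.toLeft, f j + ∑ j ∈ S.toRight, g j := by
  conv_lhs => rw [← Finset.toLeft_disjSum_toRight (u := S), Finset.sum_disjSum]
  simp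

theorem sum_irrWeight (S : Finset (Fin n)) : ∑ j ∈ S, irrWeight n j = (subsetWeight S : ℝ) := by
  simp [irrWeight, subsetWeight]

theorem fockRaising_commutator :
    fockRaising n * (fockRaising n)ᵀ - (fockRaising n)ᵀ * fockRaising n =
      diagonal fun S => ((subsetWeight S.toLeft + subsetWeight S.toRight : ℤ) : ℝ) := by
  have h : (fromBlocks (raising n) 0 0 (raising n)) * (fromBlocks (raising n) 0 0 (raising n))ᵀ -
      (fromBlocks (raising n) 0 0 (raising n))ᵀ * (fromBlocks (raising n) 0 0 (raising n)) =
      diagonal (Sum.elim (irrWeight n) (irrWeight n)) := by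
    rw [fromBlocks_transpose, fromBlocks_multiply, fromBlocks_multiply, fromBlocks_sub_fromBlocks,
      ← fromBlocks_diagonal]
    simp [raising_commutator]
  rw [fockRaising, ← secondQuant_transpose, secondQuant_commutator, h, secondQuant_diagonal]
  congr 1
  ext S
  rw [sum_sumElim, sum_irrWeight, sum_irrWeight]
  push_cast
  ring

theorem fockTransfer_commutator :
    fockTransfer n * (fockTransfer n)ᵀ - (fockTransfer n)ᵀ * fockTransfer n =
      diagonal fun S => (S.toLeft.card : ℝ) - S.toRight.card := by
  have h : (fromBlocks 0 1 0 0 : Matrix (Fin n ⊕ Fin n) (Fin n ⊕ Fin n) ℝ) *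
      (fromBlocks 0 1 0 0)ᵀ - (fromBlocks 0 1 0 0)ᵀ * (fromBlocks 0 1 0 0) =
      diagonal (Sum.elim (fun _ => 1) (fun _ => -1)) := by
    rw [fromBlocks_transpose, fromBlocks_multiply, fromBlocks_multiply, fromBlocks_sub_fromBlocks,
      ← fromBlocks_diagonal]
    simp [← diagonal_neg]
  rw [fockTransfer, ← secondQuant_transpose, secondQuant_commutator, h, secondQuant_diagonal]
  congr 1
  ext S
  rw [sum_sumElim]
  simp
  ring

/-- The first `sl₂` acts by the same block on both copies, so it commutes with exchanging them. Only
the lowering operator is needed later. -/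
theorem fockTransfer_mul_fockRaising_transpose :
    fockTransfer n * (fockRaising n)ᵀ = (fockRaising n)ᵀ * fockTransfer n := by
  rw [← sub_eq_zero, fockTransfer, fockRaising, ← secondQuant_transpose, secondQuant_commutator,
    fromBlocks_transpose, fromBlocks_multiply, fromBlocks_multiply, fromBlocks_sub_fromBlocks]
  simp [secondQuant_zero]

/-- `S` consists of `a` elements of the first copy and `b` of the second, of total weight `m`. -/
def HasTriweight (a b : ℕ) (m : ℤ) (S : Finset (Fin n ⊕ Fin n)) : Prop :=
  S.toLeft.card = a ∧ S.toRight.card = b ∧ subsetWeight S.toLeft + subsetWeight S.toRight = m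

instance (a b : ℕ) (m : ℤ) : DecidablePred (HasTriweight n a b m) := fun _ =>
  inferInstanceAs (Decidable (_ ∧ _ ∧ _))

theorem finrank_triweight (a b : ℕ) (m : ℤ) :
    (Module.finrank ℝ (supportedOn (HasTriweight n a b m)) : ℤ) =
      (quantumBinom n a * quantumBinom n b).coeff m := by
  rw [finrank_supportedOn, coeff_quantumBinom_mul]
  rfl

theorem secondQuant_triweight {A : Matrix (Fin n ⊕ Fin n) (Fin n ⊕ Fin n) ℝ} {a b c : ℤ}
    (hA : ∀ x y, A x y ≠ 0 →
      (Sum.elim (fun _ => 1) (fun _ => 0) x : ℝ) = Sum.elim (fun _ => 1) (fun _ => 0) y + a ∧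
      (Sum.elim (fun _ => 0) (fun _ => 1) x : ℝ) = Sum.elim (fun _ => 0) (fun _ => 1) y + b ∧
      Sum.elim (irrWeight n) (irrWeight n) x = Sum.elim (irrWeight n) (irrWeight n) y + c)
    {S T : Finset (Fin n ⊕ Fin n)} (hST : secondQuant A S T ≠ 0) :
    (S.toLeft.card : ℤ) = T.toLeft.card + a ∧ (S.toRight.card : ℤ) = T.toRight.card + b ∧
      subsetWeight S.toLeft + subsetWeight S.toRight =
        subsetWeight T.toLeft + subsetWeight T.toRight + c := by
  have h1 := secondQuant_apply_ne_zero (fun x y h => (hA x y h).1) hST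
  have h2 := secondQuant_apply_ne_zero (fun x y h => (hA x y h).2.1) hST
  have h3 := secondQuant_apply_ne_zero (fun x y h => (hA x y h).2.2) hST
  simp only [sum_sumElim, sum_irrWeight, Finset.sum_const, nsmul_eq_mul, mul_one, mul_zero,
    add_zero, zero_add] at h1 h2 h3
  exact ⟨by exact_mod_cast h1, by exact_mod_cast h2, by exact_mod_cast h3⟩

theorem fockRaising_triweight {S T : Finset (Fin n ⊕ Fin n)} (hST : fockRaising n S T ≠ 0) :
    (S.toLeft.card : ℤ) = T.toLeft.card + 0 ∧ (S.toRight.card : ℤ) = T.toRight.card + 0 ∧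
      subsetWeight S.toLeft + subsetWeight S.toRight =
        subsetWeight T.toLeft + subsetWeight T.toRight + 2 := by
  refine secondQuant_triweight n ?_ hST
  rintro (x | x) (y | y) h
  · simpa using raising_ne_zero n h
  · exact absurd rfl h
  · exact absurd rfl h
  · simpa using raising_ne_zero n h

theorem fockTransfer_triweight {S T : Finset (Fin n ⊕ Fin n)} (hST : fockTransfer n S T ≠ 0) :
    (S.toLeft.card : ℤ) = T.toLeft.card + 1 ∧ (S.toRight.card : ℤ) = T.toRight.card + (-1) ∧
      subsetWeight S.toLeft + subsetWeight S.toRight =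
        subsetWeight T.toLeft + subsetWeight T.toRight + 0 := by
  refine secondQuant_triweight n ?_ hST
  rintro (x | x) (y | y) h
  · exact absurd rfl h
  · have hxy : x = y := by
      by_contra hxy
      exact h (one_apply_ne hxy)
    simp [hxy]
  · exact absurd rfl h
  · exact absurd rfl h

/-- The difference `a_{k+i} a_k - a_{k+i+1} a_{k-1}` for the `n`th row of the quantum Pascal
triangle. -/
def pascalDiff (k i : ℕ) : ℤ[T;T⁻¹] :=
  quantumBinom n (k + i) * quantumBinom n k - quantumBinom n (k + i + 1) * quantumBinom n (k - 1)

/-- The highest weight vectors of the dual `sl₂` of a given weight. -/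
def dualHighest (k i : ℕ) (m : ℤ) : Submodule ℝ (Finset (Fin n ⊕ Fin n) → ℝ) :=
  supportedOn (HasTriweight n (k + i) k m) ⊓ LinearMap.ker (fockTransfer n).mulVecLin

/-- `fockTransfer` preserves the weight `m` and is onto in each weight, so the difference of
dimensions is the dimension of its kernel. -/
theorem coeff_pascalDiff {k : ℕ} (i : ℕ) (hk : 1 ≤ k) (m : ℤ) :
    (pascalDiff n k i).coeff m = Module.finrank ℝ (dualHighest n k i m) := by
  have h := finrank_inf_ker_add (A := fockTransfer n)
    (V₁ := supportedOn (HasTriweight n (k + i) k m))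
    (V₂ := supportedOn (HasTriweight n (k + i + 1) (k - 1) m)) ?_ ?_ ?_
  · have h1 : (pascalDiff n k i).coeff m = (quantumBinom n (k + i) * quantumBinom n k).coeff m -
      (quantumBinom n (k + i + 1) * quantumBinom n (k - 1)).coeff m := rfl
    rw [h1, ← finrank_triweight, ← finrank_triweight, ← h, dualHighest]
    push_cast
    ring
  · intro v hv
    refine mulVec_mem_supportedOn (fun S T hST hT => ?_) hv
    have := fockTransfer_triweight n hST
    unfold HasTriweight at hT ⊢
    omega
  · intro v hv
    refine mulVec_mem_supportedOn (fun S T hST hT => ?_) hv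
    have := fockTransfer_triweight n hST
    unfold HasTriweight at hT ⊢
    omega
  · intro v hv h0
    refine eq_zero_of_transpose_mulVec_eq_zero (fockTransfer_commutator n) (fun S hS => ?_) hv h0
    -- The dual weight is `(k + i + 1) - (k - 1) = i + 2`, hence positive.
    rw [hS.1, hS.2.1, sub_pos, Nat.cast_lt]
    omega

/-- Lowering maps the highest weight vectors of weight `m + 2` injectively to those of weight `m`,
because `m + 2 > 0`. -/
theorem coeff_pascalDiff_add_two_le {k : ℕ} (i : ℕ) (hk : 1 ≤ k) {m : ℤ} (hm : -1 ≤ m) :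
    (pascalDiff n k i).coeff (m + 2) ≤ (pascalDiff n k i).coeff m := by
  rw [coeff_pascalDiff n i hk, coeff_pascalDiff n i hk, Nat.cast_le]
  refine finrank_le_of_mulVec (A := (fockRaising n)ᵀ) ?_ ?_
  · rintro v ⟨hv, hv'⟩
    refine ⟨mulVec_mem_supportedOn (fun S T hST hT => ?_) hv, ?_⟩
    · have := fockRaising_triweight n hST
      unfold HasTriweight at hT ⊢
      omega
    · have h1 : fockTransfer n *ᵥ v = 0 := hv'
      rw [SetLike.mem_coe, LinearMap.mem_ker, mulVecLin_apply, mulVec_mulVec,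
        fockTransfer_mul_fockRaising_transpose, ← mulVec_mulVec, h1, mulVec_zero]
  · rintro v ⟨hv, -⟩ h0
    refine eq_zero_of_transpose_mulVec_eq_zero (fockRaising_commutator n) (fun S hS => ?_) hv h0
    rw [hS.2.2, Int.cast_pos]
    omega

theorem isNonneg_pascalDiff {k : ℕ} (i : ℕ) (hk : 1 ≤ k) : IsNonneg (pascalDiff n k i) := by
  intro m
  rw [coeff_pascalDiff n i hk]
  exact Int.natCast_nonneg _

theorem isCentred_pascalDiff (k i : ℕ) : IsCentred (pascalDiff n k i) := by
  simp [IsCentred, pascalDiff, invert_quantumBinom]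

end Howe

/-! ### From decreasing coefficients to unimodality and quantum integers. -/

section Characters

open LaurentPolynomial

theorem coeff_neg_of_isCentred {f : ℤ[T;T⁻¹]} (hf : IsCentred f) (m : ℤ) :
    f.coeff (-m) = f.coeff m := by
  rw [← invert_apply, hf]

theorem isUnimodal_of_coeff_le {f : ℤ[T;T⁻¹]} (hf : IsCentred f)
    (h : ∀ m : ℤ, -1 ≤ m → f.coeff (m + 2) ≤ f.coeff m) : IsUnimodal f := by
  intro r
  have hanti : ∀ s : ℤ, AntitoneOn (fun m : ℤ => f.coeff (2 * m + s)) {m | -1 ≤ 2 * m + s} := by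
    intro s a ha b _ hab
    obtain ⟨d, rfl⟩ := Int.le.dest hab
    clear hab
    induction d with
    | zero => simp
    | succ d ih =>
      have ha' : -1 ≤ 2 * a + s := ha
      have h1 := h (2 * (a + d) + s) (by omega)
      refine le_trans (le_of_eq ?_) (h1.trans (ih ?_))
      · simp only
        congr 1
        push_cast
        ring
      · simp only [Set.mem_ofPred_eq]
        omega
  -- Rounding down puts the peak exponent `2p + r` at `0` or `-1`. The rising half is the reflection
  -- of a falling half of the class of `-r`.
  refine ⟨-r / 2, ?_, ?_⟩
  · intro a ha b hb hab
    rw [Set.mem_Iic] at ha hb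
    have h1 := hanti (-r) (a := -b) (b := -a) (by simp only [Set.mem_ofPred_eq]; omega)
      (by simp only [Set.mem_ofPred_eq]; omega) (by omega)
    simp only at h1 ⊢
    rw [← coeff_neg_of_isCentred hf (2 * a + r), ← coeff_neg_of_isCentred hf (2 * b + r)]
    convert h1 using 2 <;> ring
  · refine (hanti r).mono fun a ha => ?_
    rw [Set.mem_Ici] at ha
    simp only [Set.mem_ofPred_eq]
    omega

theorem coeff_mul_T_sub_T (f : ℤ[T;T⁻¹]) (j : ℤ) :
    (f * (T (-1) - T 1)).coeff j = f.coeff (j + 1) - f.coeff (j - 1) := by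
  have h : ∀ k : ℤ, (f * T k).coeff j = f.coeff (j - k) := by
    intro k
    rw [T, AddMonoidAlgebra.coeff_mul_single_eq_coeff_mul (j - k) fun m _ => by omega, mul_one]
  rw [mul_sub]
  change (f * T (-1)).coeff j - (f * T 1).coeff j = _
  rw [h, h, sub_neg_eq_add]

theorem isQuantumIntPositive_zero : IsQuantumIntPositive 0 := ⟨0, by simp⟩

theorem IsQuantumIntPositive.add {a b : ℤ[T;T⁻¹]} (ha : IsQuantumIntPositive a)
    (hb : IsQuantumIntPositive b) : IsQuantumIntPositive (a + b) := by
  obtain ⟨c, rfl⟩ := ha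
  obtain ⟨d, rfl⟩ := hb
  exact ⟨c + d, (Finsupp.sum_add_index' (by simp) (fun _ _ _ => add_smul _ _ _)).symm⟩

theorem isQuantumIntPositive_smul (m r : ℕ) : IsQuantumIntPositive (r • quantumInt (m + 1)) :=
  ⟨Finsupp.single m r, by simp⟩

/-- The multiplicity of `[m + 1]` is `f_m - f_{m+2}`, as for highest weights of `sl₂`. -/
theorem isQuantumIntPositive_of_coeff_le {f : ℤ[T;T⁻¹]} (hf : IsCentred f)
    (h : ∀ m : ℤ, -1 ≤ m → f.coeff (m + 2) ≤ f.coeff m) : IsQuantumIntPositive f := by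
  obtain ⟨N, hN⟩ : ∃ N : ℕ, ∀ m : ℤ, N ≤ m → f.coeff m = 0 := by
    refine ⟨f.coeff.support.sup Int.natAbs + 1, fun m hm => ?_⟩
    by_contra h0
    have := Finset.le_sup (f := Int.natAbs) (Finsupp.mem_support_iff.mpr h0)
    omega
  have key : f = ∑ m ∈ Finset.range N,
      (f.coeff m - f.coeff (m + 2)).toNat • quantumInt (m + 1) := by
    -- Multiplication by `q⁻¹ - q` turns each quantum integer into two monomials, so at most one
    -- summand contributes to each coefficient.
    apply mul_right_cancel₀ T_sub_T_ne_zero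
    rw [Finset.sum_mul]
    simp only [smul_mul_assoc, quantumInt_mul]
    ext j
    rw [coeff_mul_T_sub_T, coeff_finset_sum]
    have h1 : ∀ m ∈ Finset.range N, ((f.coeff m - f.coeff (m + 2)).toNat •
        (T (-((m + 1 : ℕ) : ℤ)) - T ((m + 1 : ℕ) : ℤ) : ℤ[T;T⁻¹])).coeff j =
        (f.coeff m - f.coeff (m + 2)) * ((if -((m + 1 : ℕ) : ℤ) = j then 1 else 0) -
          if ((m + 1 : ℕ) : ℤ) = j then 1 else 0) := by
      intro m _
      have h2 : 0 ≤ f.coeff m - f.coeff (m + 2) := sub_nonneg.mpr (h m (by omega))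
      rw [← T_apply, ← T_apply]
      conv_rhs => rw [← Int.toNat_of_nonneg h2]
      rw [← nsmul_eq_mul]
      rfl
    rw [Finset.sum_congr rfl h1]
    have h3 : ∀ p : ℕ, N ≤ p → f.coeff p - f.coeff (p + 2) = 0 := fun p hp => by
      rw [hN _ (by omega), hN _ (by omega), sub_zero]
    rcases lt_trichotomy j 0 with hj | rfl | hj
    · obtain ⟨p, rfl⟩ : ∃ p : ℕ, j = -((p : ℤ) + 1) := ⟨(-j - 1).toNat, by omega⟩
      rw [Finset.sum_eq_single p]
      · rw [if_pos (by push_cast; ring), if_neg (by omega), ← coeff_neg_of_isCentred hf p,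
          ← coeff_neg_of_isCentred hf (p + 2)]
        ring_nf
      · intro m _ hm
        rw [if_neg (by omega), if_neg (by omega)]; simp
      · intro hp
        rw [h3 p (by simpa using hp), zero_mul]
    · rw [Finset.sum_eq_zero fun m _ => by rw [if_neg (by omega), if_neg (by omega)]; simp]
      rw [zero_add, zero_sub, coeff_neg_of_isCentred hf, sub_self]
    · obtain ⟨p, rfl⟩ : ∃ p : ℕ, j = (p : ℤ) + 1 := ⟨(j - 1).toNat, by omega⟩
      rw [Finset.sum_eq_single p]
      · rw [if_neg (by omega), if_pos (by push_cast; ring)]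
        ring_nf
      · intro m _ hm
        rw [if_neg (by omega), if_neg (by omega)]; simp
      · intro hp
        rw [h3 p (by simpa using hp), zero_mul]
  rw [key]
  exact Finset.sum_induction _ _ (fun _ _ => IsQuantumIntPositive.add) isQuantumIntPositive_zero
    fun m _ => isQuantumIntPositive_smul m _

/-! ### Characters of `SL₂(ℂ)` and binary forms. -/

theorem isSL2Character_zero : IsSL2Character 0 :=
  ⟨PUnit, inferInstance, inferInstance, inferInstance, 1, fun q => by
    rw [map_zero, Subsingleton.elim (((1 : Representation ℂ SL(2, ℂ) PUnit)) (torusElement q)) 0,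
      map_zero]⟩

theorem IsSL2Character.add {a b : ℤ[T;T⁻¹]} (ha : IsSL2Character a) (hb : IsSL2Character b) :
    IsSL2Character (a + b) := by
  obtain ⟨V, _, _, _, ρ, hρ⟩ := ha
  obtain ⟨W, _, _, _, σ, hσ⟩ := hb
  refine ⟨V × W, inferInstance, inferInstance, inferInstance, ρ.prod σ, fun q => ?_⟩
  rw [map_add, ← hρ, ← hσ]
  exact LinearMap.trace_prodMap' _ _

theorem IsSL2Character.nsmul {a : ℤ[T;T⁻¹]} (ha : IsSL2Character a) (r : ℕ) :
    IsSL2Character (r • a) := by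
  induction r with
  | zero => simpa using isSL2Character_zero
  | succ r ih => rw [succ_nsmul]; exact ih.add ha

theorem trace_eq_sum_of_basis {ι V : Type*} [Fintype ι] [AddCommGroup V] [Module ℂ V]
    (b : Module.Basis ι ℂ V) (f : V →ₗ[ℂ] V) (c : ι → ℂ) (h : ∀ i, f (b i) = c i • b i) :
    LinearMap.trace ℂ V f = ∑ i, c i := by
  classical
  rw [LinearMap.trace_eq_matrix_trace ℂ b]
  refine Finset.sum_congr rfl fun i _ => ?_
  rw [Matrix.diag_apply, LinearMap.toMatrix_apply, h]
  simp

/-- The substitution action of matrices on binary forms. -/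
def linearSubst (g : Matrix (Fin 2) (Fin 2) ℂ) :
    MvPolynomial (Fin 2) ℂ →ₐ[ℂ] MvPolynomial (Fin 2) ℂ :=
  MvPolynomial.aeval fun i => ∑ j, MvPolynomial.C (g j i) * MvPolynomial.X j

theorem linearSubst_one : linearSubst 1 = AlgHom.id ℂ _ := by
  ext1 i
  simp [linearSubst, Matrix.one_apply]

/-- The variable `X i` is sent to the form given by column `i`, so composition keeps the order of
the factors and no inverse is needed for a left action. -/
theorem linearSubst_mul (g h : Matrix (Fin 2) (Fin 2) ℂ) :
    linearSubst (g * h) = (linearSubst g).comp (linearSubst h) := by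
  ext1 i
  simp [linearSubst, Matrix.mul_apply, MvPolynomial.algHom_C]
  ring

theorem isHomogeneous_linearSubst (g : Matrix (Fin 2) (Fin 2) ℂ) {m : ℕ}
    {p : MvPolynomial (Fin 2) ℂ} (hp : p.IsHomogeneous m) :
    (linearSubst g p).IsHomogeneous m := by
  have h := hp.aeval (n := 1) (fun i => ∑ j, MvPolynomial.C (g j i) * MvPolynomial.X j)
    fun i => MvPolynomial.IsHomogeneous.sum _ _ _ fun j _ => by
      simpa using (MvPolynomial.isHomogeneous_C (Fin 2) (g j i)).mul
        (MvPolynomial.isHomogeneous_X ℂ j)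
  rwa [one_mul] at h

/-- The irreducible representation of `SL₂(ℂ)` on binary forms of degree `m`. -/
def binaryForms (m : ℕ) :
    Representation ℂ SL(2, ℂ) (MvPolynomial.homogeneousSubmodule (Fin 2) ℂ m) where
  toFun g := (linearSubst g.1).toLinearMap.restrict fun _ hp => isHomogeneous_linearSubst g.1 hp
  map_one' := by
    ext1 p
    apply Subtype.ext
    change linearSubst (1 : SL(2, ℂ)).1 p.1 = p.1
    rw [Matrix.SpecialLinearGroup.coe_one, linearSubst_one]
    rfl
  map_mul' g h := by
    ext1 p
    apply Subtype.ext
    change linearSubst (g * h).1 p.1 = linearSubst g.1 (linearSubst h.1 p.1)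
    rw [Matrix.SpecialLinearGroup.coe_mul, linearSubst_mul]
    rfl

/-- Exponents of monomials of degree `m` in two variables. -/
def binaryExponentEquiv (m : ℕ) : {d : Fin 2 →₀ ℕ | d.degree = m} ≃ Fin (m + 1) where
  toFun d := ⟨d.1 0, by
    have h : d.1.degree = m := d.2
    rw [Finsupp.degree_eq_sum, Fin.sum_univ_two] at h
    omega⟩
  invFun j := ⟨Finsupp.single 0 (j : ℕ) + Finsupp.single 1 (m - j), by
    simp only [Set.mem_ofPred_eq, map_add, Finsupp.degree_single]
    omega⟩
  left_inv d := by
    have h : d.1.degree = m := d.2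
    rw [Finsupp.degree_eq_sum, Fin.sum_univ_two] at h
    ext i
    fin_cases i
    · simp
    · simp
      omega
  right_inv j := by simp

/-- The monomial basis of binary forms of degree `m`. -/
def binaryFormsBasis (m : ℕ) :
    Module.Basis (Fin (m + 1)) ℂ (MvPolynomial.homogeneousSubmodule (Fin 2) ℂ m) :=
  ((MvPolynomial.basisRestrictSupport ℂ {d : Fin 2 →₀ ℕ | d.degree = m}).map
    (LinearEquiv.ofEq _ _
      (MvPolynomial.homogeneousSubmodule_eq_finsupp_supported (Fin 2) ℂ m).symm)).reindex
    (binaryExponentEquiv m)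

theorem binaryFormsBasis_coe (m : ℕ) (j : Fin (m + 1)) :
    (binaryFormsBasis m j : MvPolynomial (Fin 2) ℂ) =
      MvPolynomial.X 0 ^ (j : ℕ) * MvPolynomial.X 1 ^ (m - j : ℕ) := by
  have h : ∀ d : {d : Fin 2 →₀ ℕ | d.degree = m},
      (MvPolynomial.basisRestrictSupport ℂ {d : Fin 2 →₀ ℕ | d.degree = m} d).1 =
        MvPolynomial.monomial d.1 1 := by
    intro d
    classical
    change AddMonoidAlgebra.ofCoeff
      ((Finsupp.supportedEquivFinsupp {d : Fin 2 →₀ ℕ | d.degree = m}).symm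
        (Finsupp.single d (1 : ℂ))).1 = _
    rw [Finsupp.supportedEquivFinsupp_symm_single]
    rfl
  rw [binaryFormsBasis, Module.Basis.reindex_apply, Module.Basis.map_apply]
  refine (h _).trans ?_
  rw [MvPolynomial.X_pow_eq_monomial, MvPolynomial.X_pow_eq_monomial, MvPolynomial.monomial_mul,
    one_mul]
  rfl

theorem binaryForms_torusElement (m : ℕ) (q : ℂˣ) (j : Fin (m + 1)) :
    binaryForms m (torusElement q) (binaryFormsBasis m j) =
      ((q ^ (2 * (j : ℤ) - m) : ℂˣ) : ℂ) • binaryFormsBasis m j := by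
  apply Subtype.ext
  change linearSubst (torusElement q).1 (binaryFormsBasis m j).1 = _ • (binaryFormsBasis m j).1
  have h0 : linearSubst (torusElement q).1 (MvPolynomial.X 0) =
      (q : ℂ) • MvPolynomial.X 0 := by
    simp [linearSubst, torusElement, MvPolynomial.smul_eq_C_mul]
  have h1 : linearSubst (torusElement q).1 (MvPolynomial.X 1) =
      ((q⁻¹ : ℂˣ) : ℂ) • MvPolynomial.X 1 := by
    simp [linearSubst, torusElement, MvPolynomial.smul_eq_C_mul]
  -- The monomial `X₀^j X₁^(m-j)` has weight `j - (m - j)`.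
  have h2 : (q ^ (2 * (j : ℤ) - m) : ℂˣ) = q ^ (j : ℕ) * q⁻¹ ^ (m - j : ℕ) := by
    rw [← zpow_natCast, ← zpow_natCast, inv_zpow', ← zpow_add]
    congr 1
    omega
  rw [binaryFormsBasis_coe, map_mul, map_pow, map_pow, h0, h1, smul_pow, smul_pow,
    smul_mul_smul_comm, h2, Units.val_mul, Units.val_pow_eq_pow_val, Units.val_pow_eq_pow_val]

theorem isSL2Character_quantumInt (m : ℕ) : IsSL2Character (quantumInt (m + 1)) := by
  refine ⟨MvPolynomial.homogeneousSubmodule (Fin 2) ℂ m, inferInstance, inferInstance,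
    Module.Finite.of_basis (binaryFormsBasis m), binaryForms m, fun q => ?_⟩
  rw [trace_eq_sum_of_basis (binaryFormsBasis m) _ _ (binaryForms_torusElement m q), quantumInt,
    map_sum, Finset.sum_range]
  refine Finset.sum_congr rfl fun j _ => ?_
  rw [eval₂_T]
  congr 2
  push_cast
  ring

theorem IsQuantumIntPositive.isSL2Character {a : ℤ[T;T⁻¹]} (ha : IsQuantumIntPositive a) :
    IsSL2Character a := by
  obtain ⟨c, rfl⟩ := ha
  exact Finset.sum_induction _ _ (fun _ _ => IsSL2Character.add) isSL2Character_zero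
    fun m _ => (isSL2Character_quantumInt m).nsmul _

end Characters

end QuantumPascal

end

theorem mainTheorem2 (n : ℕ) :
    QuantumPascal.StronglySchurLogConcave (fun k => QuantumPascal.quantumBinom n k) ∧
      ∀ k i : ℕ, 1 ≤ k →
        QuantumPascal.IsQuantumIntPositive
            (QuantumPascal.quantumBinom n (k + i) * QuantumPascal.quantumBinom n k -
              QuantumPascal.quantumBinom n (k + i + 1) * QuantumPascal.quantumBinom n (k - 1)) ∧
          QuantumPascal.IsSL2Character
            (QuantumPascal.quantumBinom n (k + i) * QuantumPascal.quantumBinom n k -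
              QuantumPascal.quantumBinom n (k + i + 1) * QuantumPascal.quantumBinom n (k - 1)) := by
  have h : ∀ k i : ℕ, 1 ≤ k →
      QuantumPascal.IsQuantumIntPositive (QuantumPascal.pascalDiff n k i) := fun k i hk =>
    QuantumPascal.isQuantumIntPositive_of_coeff_le (QuantumPascal.isCentred_pascalDiff n k i)
      fun _ => QuantumPascal.coeff_pascalDiff_add_two_le n i hk
  exact ⟨⟨QuantumPascal.isNonneg_quantumBinom n, fun k i hk =>
    ⟨QuantumPascal.isNonneg_pascalDiff n i hk, QuantumPascal.isCentred_pascalDiff n k i,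
      QuantumPascal.isUnimodal_of_coeff_le (QuantumPascal.isCentred_pascalDiff n k i)
        fun _ => QuantumPascal.coeff_pascalDiff_add_two_le n i hk⟩⟩,
    fun k i hk => ⟨h k i hk, (h k i hk).isSL2Character⟩⟩
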